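/- Let $n\ge 0$ be an integer and let $A=\{1<2<\dots<n\}$. The hypoplactic monoid $H_n$ of rank $n$ is the monoid presented by the generators $A$ and the relations $$acb=cab\ (a\le b<c),\qquad bac=bca\ (a<b\le c),$$ $$cadb=acbd\ (a\le b<c\le d),\qquad bdac=dbca\ (a<b\le c<d),$$ where $a,b,c,d\in A$. A column is a strictly decreasing nonempty word over $A$. A word over $A$, written as the product $\alpha^{(1)}\cdots\alpha^{(k)}$ of columns of maximal length, is a quasi-ribbon word if, for each $i<k$, the first (greatest) symbol of $\alpha^{(i)}$ is less than or equal to the last (smallest) symbol of $\alpha^{(i+1)}$. Let $L\subseteq A^*$ be the language of quasi-ribbon words. Let $\$$ be a symbol not in $A$. For $u,v\in A^*$, let $(u,v)\delta_{\mathrm R}$ (respectively $(u,v)\delta_{\mathrm L}$) be the word over $(A\cup\{\$\})\times(A\cup\{\$\})$ obtained by appending (respectively prepending) symbols $\$$ to the shorter of $u$ and $v$ until the lengths agree and then pairing the symbols position by position. For $a\in A\cup\{\varepsilon\}$ put $$L_a=\{(u,v): u,v\in L,\ ua=_{H_n}v\},\qquad {}_aL=\{(u,v): u,v\in L,\ au=_{H_n}v\}.$$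 Then $(A,L)$ is a biautomatic structure for $H_n$. That is: $A$ is a finite set generating $H_n$; $L$ is regular; every element of $H_n$ is represented by at least one word in $L$; and for every $a\in A\cup\{\varepsilon\}$ the four languages $L_a\delta_{\mathrm R}$, ${}_aL\delta_{\mathrm R}$, $L_a\delta_{\mathrm L}$ and ${}_aL\delta_{\mathrm L}$ are regular. -/

import Mathlib

/-!
Words over `A` are lists.  The padding symbol `$` is `none : Option A`, so that
`(A ∪ {$}) × (A ∪ {$})` is `Option A × Option A`, and `A ∪ {ε}` is again `Option A`, with `none`
for the empty word.
-/

section Biautomatic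

variable {A M : Type*} [Monoid M]

/-- The map `δ_R`: read two words in parallel, padding the shorter one with `$` on the right. -/
def deltaR (u v : List A) : List (Option A × Option A) :=
  List.zip (u.map some ++ List.replicate (v.length - u.length) none)
    (v.map some ++ List.replicate (u.length - v.length) none)

/-- The map `δ_L`: read two words in parallel, padding the shorter one with `$` on the left. -/
def deltaL (u v : List A) : List (Option A × Option A) :=
  List.zip (List.replicate (v.length - u.length) none ++ u.map some)
    (List.replicate (u.length - v.length) none ++ v.map some)

/-- The language `R δ_R` over `(A ∪ {$}) × (A ∪ {$})`. -/
def paddedR (R : Set (List A × List A)) : Language (Option A × Option A) :=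
  {w | ∃ p ∈ R, deltaR p.1 p.2 = w}

/-- The language `R δ_L` over `(A ∪ {$}) × (A ∪ {$})`. -/
def paddedL (R : Set (List A × List A)) : Language (Option A × Option A) :=
  {w | ∃ p ∈ R, deltaL p.1 p.2 = w}

/-- The element of `M` represented by a word over `A`, where `a : A` represents `φ a`. -/
def wordValue (φ : A → M) (w : List A) : M :=
  (w.map φ).prod

/-- The relation `L_a = {(u, v) : u, v ∈ L, u a =_M v}` for `a ∈ A ∪ {ε}`. -/
def rightMulRel (φ : A → M) (L : Language A) (a : Option A) : Set (List A × List A) :=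
  {p | p.1 ∈ L ∧ p.2 ∈ L ∧ wordValue φ (p.1 ++ a.toList) = wordValue φ p.2}

/-- The relation `ₐL = {(u, v) : u, v ∈ L, a u =_M v}` for `a ∈ A ∪ {ε}`. -/
def leftMulRel (φ : A → M) (L : Language A) (a : Option A) : Set (List A × List A) :=
  {p | p.1 ∈ L ∧ p.2 ∈ L ∧ wordValue φ (a.toList ++ p.1) = wordValue φ p.2}

/-- `(A, L)` is a biautomatic structure for the monoid `M`, where the letter `a` of the alphabet
`A` represents the element `φ a` of `M`. -/
structure IsBiautomaticStructure (φ : A → M) (L : Language A) : Prop where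
  finite_alphabet : Finite A
  generates : Submonoid.closure (Set.range φ) = ⊤
  regular : L.IsRegular
  represents : ∀ m : M, ∃ w ∈ L, wordValue φ w = m
  right_deltaR : ∀ a : Option A, (paddedR (rightMulRel φ L a)).IsRegular
  left_deltaR : ∀ a : Option A, (paddedR (leftMulRel φ L a)).IsRegular
  right_deltaL : ∀ a : Option A, (paddedL (rightMulRel φ L a)).IsRegular
  left_deltaL : ∀ a : Option A, (paddedL (leftMulRel φ L a)).IsRegular

end Biautomatic

section Hypoplactic

open FreeMonoid in
/-- The defining relations of the hypoplactic monoid of rank `n`: the Knuth relations together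
with the quartic relations of Krob and Thibon. -/
inductive HypoplacticRel (n : ℕ) : FreeMonoid (Fin n) → FreeMonoid (Fin n) → Prop
  | knuth₁ (a b c : Fin n) (hab : a ≤ b) (hbc : b < c) :
      HypoplacticRel n (of a * of c * of b) (of c * of a * of b)
  | knuth₂ (a b c : Fin n) (hab : a < b) (hbc : b ≤ c) :
      HypoplacticRel n (of b * of a * of c) (of b * of c * of a)
  | quartic₁ (a b c d : Fin n) (hab : a ≤ b) (hbc : b < c) (hcd : c ≤ d) :
      HypoplacticRel n (of c * of a * of d * of b) (of a * of c * of b * of d)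
  | quartic₂ (a b c d : Fin n) (hab : a < b) (hbc : b ≤ c) (hcd : c < d) :
      HypoplacticRel n (of b * of d * of a * of c) (of d * of b * of c * of a)

/-- The hypoplactic monoid of rank `n`. -/
abbrev HypoplacticMonoid (n : ℕ) : Type :=
  PresentedMonoid (HypoplacticRel n)

/-- The decomposition of a word as a product of columns (strictly decreasing nonempty words) of
maximal length. -/
def maximalColumns {n : ℕ} (w : List (Fin n)) : List (List (Fin n)) :=
  w.splitBy fun x y => decide (x > y)

/-- The first (greatest) symbol of the column `α` is less than or equal to the last (smallest)
symbol of the column `β`. -/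
def ColumnPrec {n : ℕ} (α β : List (Fin n)) : Prop :=
  ∀ x ∈ α.head?, ∀ y ∈ β.getLast?, x ≤ y

/-- A word is a quasi-ribbon word if consecutive columns `α`, `β` of its decomposition into maximal
columns satisfy `ColumnPrec α β`. -/
def IsQuasiRibbonWord {n : ℕ} (w : List (Fin n)) : Prop :=
  (maximalColumns w).IsChain ColumnPrec

/-- The language of quasi-ribbon words over `{1 < 2 < ⋯ < n}`, modelled as `Fin n`. -/
def quasiRibbonWords (n : ℕ) : Language (Fin n) :=
  {w | IsQuasiRibbonWord w}

end Hypoplactic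

/-!
Quasi-ribbon words are described by a condition on subsequences of length three
(`isQuasiRibbonWord_iff`): whenever a letter is followed, anywhere, by a smaller one, the word
decreases strictly between the two. Equality in the hypoplactic monoid is described by invariants
(`wordCongr_iff_sameInvariants`): two words are congruent exactly if they have the same content
and, for all letters `a < b` consecutive in the support, agree on whether some `b` precedes
some `a`.

The invariants are preserved by the defining relations. Conversely, the defining relations say that
adjacent letters `x < y` commute if the letter after them lies in `[x, y)` or the letter before them
lies in `(x, y]`, together with two simultaneous such exchanges. By induction on the distance, the
letter that permits the exchange may stand anywhere in the word (`swapUpTo`). A word with the least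
number of inversions that such exchanges can reach is a quasi-ribbon word
(`exists_wordCongr_decreasesBetweenInversions`), and a quasi-ribbon word is determined by its
invariants (`eq_of_sameInvariants`).

Being a quasi-ribbon word and having prescribed inversions only depend on the subsequences of length
at most three, which a finite automaton can collect. It remains to compare the contents of two words
read in parallel. In a quasi-ribbon word every prefix already contains all but at most one of the
occurrences of each letter smaller than its greatest letter. Hence, if two quasi-ribbon words have
contents that differ by at most one letter, their prefixes of nearly equal length have contents at
bounded distance (`abs_count_sub_count_le`), and a finite automaton can keep track of the
difference. This works in the same way for all four padded languages (`IsPadding.isRegular`).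
-/

/-! ### Quasi-ribbon words by pattern avoidance -/

namespace Hypoplactic

/-- A list either satisfies `p` throughout, or splits at its first element without `p`. -/
theorem _root_.List.forall_or_exists_first_not {α : Type*} (p : α → Prop) (s : List α) :
    (∀ z ∈ s, p z) ∨ ∃ l q s', s = l ++ q :: s' ∧ (∀ z ∈ l, p z) ∧ ¬ p q := by
  induction s with
  | nil => simp
  | cons a s ih =>
    by_cases ha : p a
    · rcases ih with h | ⟨l, q, s', rfl, hl, hq⟩
      · exact .inl (by simpa [ha] using h)
      · exact .inr ⟨a :: l, q, s', by simp, by simpa [ha] using hl, hq⟩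
    · exact .inr ⟨[], a, s, by simp, by simp, ha⟩

theorem pair_sublist_or {α : Type*} {l : List α} {a b : α} (ha : a ∈ l) (hb : b ∈ l) (hab : a ≠ b) :
    [a, b].Sublist l ∨ [b, a].Sublist l := by
  induction l with
  | nil => simp at ha
  | cons x l ih =>
    by_cases hax : a = x
    · subst hax
      exact .inl ((List.singleton_sublist.2 (List.mem_of_ne_of_mem hab.symm hb)).cons_cons a)
    by_cases hbx : b = x
    · subst hbx
      exact .inr ((List.singleton_sublist.2 (List.mem_of_ne_of_mem hab ha)).cons_cons b)
    · exact (ih (List.mem_of_ne_of_mem hax ha) (List.mem_of_ne_of_mem hbx hb)).imp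
        (·.cons x) (·.cons x)

theorem pair_sublist_append {α : Type*} {u v : List α} {a b : α} :
    [b, a].Sublist (u ++ v) ↔ [b, a].Sublist u ∨ (b ∈ u ∧ a ∈ v) ∨ [b, a].Sublist v := by
  constructor
  · intro h
    obtain ⟨l₁, l₂, h, h₁, h₂⟩ := List.sublist_append_iff.1 h
    rcases l₁ with _ | ⟨x, _ | ⟨y, l₁⟩⟩
    · obtain rfl : l₂ = [b, a] := by simpa using h.symm
      exact .inr (.inr h₂)
    · obtain ⟨rfl, rfl⟩ : b = x ∧ l₂ = [a] := by simpa [eq_comm] using h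
      exact .inr (.inl ⟨List.singleton_sublist.1 h₁, List.singleton_sublist.1 h₂⟩)
    · obtain ⟨rfl, rfl, rfl, rfl⟩ : b = x ∧ a = y ∧ l₁ = [] ∧ l₂ = [] := by
        simpa [eq_comm] using h
      exact .inl h₁
  · rintro (h | ⟨hb, ha⟩ | h)
    · exact h.trans (List.sublist_append_left u v)
    · exact (List.singleton_sublist.2 hb).append (List.singleton_sublist.2 ha)
    · exact h.trans (List.sublist_append_right u v)

section Words

variable {α : Type*} [LinearOrder α]

/-- Whenever a letter of the word is followed, anywhere, by a smaller one, the word decreases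
strictly between the two. This is a condition on the subsequences of length three. -/
def DecreasesBetweenInversions (w : List α) : Prop :=
  ∀ x y z, [x, y, z].Sublist w → z < x → z < y ∧ y < x

theorem DecreasesBetweenInversions.sublist {u v : List α} (h : DecreasesBetweenInversions v)
    (huv : u.Sublist v) : DecreasesBetweenInversions u :=
  fun x y z hs => h x y z (hs.trans huv)

/-- A word made of strictly decreasing columns, each bounded above by all later letters,
decreases between inversions. -/
theorem decreasesBetweenInversions_flatten {cols : List (List α)}
    (hc : ∀ c ∈ cols, c.Pairwise (· > ·))
    (hp : cols.Pairwise fun c d => ∀ x ∈ c, ∀ y ∈ d, x ≤ y) :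
    DecreasesBetweenInversions cols.flatten := by
  induction cols with
  | nil => intro x y z h; simp at h
  | cons c cols ih =>
    intro x y z h hzx
    rw [List.pairwise_cons] at hp
    have hxz : x ∈ c → z ∈ cols.flatten → False := fun hx hz => by
      obtain ⟨d, hd, hz⟩ := List.mem_flatten.1 hz
      exact hzx.not_ge (hp.1 d hd x hx z hz)
    rw [List.flatten_cons] at h
    obtain ⟨l₁, l₂, h, h₁, h₂⟩ := List.sublist_append_iff.1 h
    rcases l₁ with _ | ⟨x', l₁⟩
    · simp only [List.nil_append] at h
      exact ih (fun c hc' => hc c (by simp [hc'])) hp.2 x y z (h ▸ h₂) hzx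
    · obtain ⟨rfl, h⟩ : x = x' ∧ [y, z] = l₁ ++ l₂ := by simpa using h
      rcases l₂.eq_nil_or_concat with rfl | ⟨l₂, z', rfl⟩
      · have := (hc c (by simp)).sublist h₁
        obtain rfl : [y, z] = l₁ := by simpa using h
        simp only [List.pairwise_cons, List.mem_cons, List.not_mem_nil] at this
        exact ⟨this.2.1 z (by simp), this.1 y (by simp)⟩
      · have hz : z = z' := by
          simpa using (List.append_inj' (show [y] ++ [z] = (l₁ ++ l₂) ++ [z'] by
            simpa using h) rfl).2
        exact (hxz (h₁.subset (by simp)) (h₂.subset (by simp [hz]))).elim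

/-- In a word without a reducible descent, the letters from one letter to a later smaller one
decrease strictly. A descent `y x` is reducible if a letter in `[x, y)` occurs to its right or a
letter in `(x, y]` occurs to its left. -/
theorem pairwise_of_forall_descent {w : List α}
    (hw : ∀ p s : List α, ∀ x y : α, w = p ++ y :: x :: s → x < y →
      (∀ z ∈ s, x ≤ z → y ≤ z) ∧ (∀ z ∈ p, x < z → y < z)) (m p s : List α) (x z : α)
    (h : w = p ++ x :: m ++ z :: s) (hzx : z < x) : (x :: m ++ [z]).Pairwise (· > ·) := by
  induction hk : m.length using Nat.strong_induction_on generalizing m p s x z with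
  | _ k ih =>
  subst hk
  by_cases hm : ∃ y ∈ m, z < y ∧ y < x
  · -- The letter `y` splits the factor into two shorter ones, which decrease by induction.
    obtain ⟨y, hy, hzy, hyx⟩ := hm
    obtain ⟨m₁, m₂, rfl⟩ := List.append_of_mem hy
    have h₁ := ih m₁.length (by simp) m₁ p (m₂ ++ z :: s) x y (by simpa using h) hyx rfl
    have h₂ := ih m₂.length (by simp; omega) m₂ (p ++ x :: m₁) s y z (by simpa using h) hzy rfl
    have := List.pairwise_append.1 h₁
    have e : x :: (m₁ ++ y :: m₂) ++ [z] = (x :: m₁) ++ (y :: m₂ ++ [z]) := by simp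
    rw [e, List.pairwise_append]
    refine ⟨this.1, h₂, fun a ha b hb => ?_⟩
    have hay : y < a := this.2.2 a ha y (by simp)
    rcases List.mem_cons.1 hb with rfl | hb
    · exact hay
    · exact ((List.pairwise_cons.1 h₂).1 b hb).trans hay
  · -- A letter at least `x` is followed by one at most `z`: a reducible descent, unless `m = []`.
    push Not at hm
    rcases (x :: m ++ [z]).forall_or_exists_first_not (x ≤ ·) with h' | ⟨l, b, r, hr, hl, hb⟩
    · exact absurd (h' z (by simp)) hzx.not_ge
    rcases l.eq_nil_or_concat with rfl | ⟨l, a, rfl⟩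
    · simp at hr
      exact absurd hr.1.le hb
    have hxa : x ≤ a := hl a (by simp)
    have hbx : b < x := not_le.1 hb
    have hbz : b ≤ z := by
      have : b ∈ x :: m ++ [z] := by simp [hr]
      simp only [List.cons_append, List.mem_cons, List.mem_append, List.not_mem_nil, or_false]
        at this
      rcases this with rfl | hbm | rfl
      · exact absurd le_rfl hb
      · by_contra hzb
        exact hb (hm b hbm (not_le.1 hzb))
      · exact le_rfl
    obtain ⟨hs, hp⟩ := hw (p ++ l) (r ++ s) b a (by
      rw [h, show p ++ x :: m ++ z :: s = p ++ (x :: m ++ [z]) ++ s by simp, hr]; simp)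
      (hbx.trans_le hxa)
    have hl' : l = [] := by
      rcases l with _ | ⟨x', l⟩
      · rfl
      · obtain rfl : x = x' := by simp at hr; exact hr.1
        exact absurd (hp x (by simp) hbx) hxa.not_gt
    have hr' : r = [] := by
      rcases r.eq_nil_or_concat with rfl | ⟨r, z', rfl⟩
      · rfl
      · obtain rfl : z = z' := by
          simpa using (List.append_inj' (show (x :: m) ++ [z] = (l ++ a :: b :: r) ++ [z'] by
            simpa using hr) rfl).2
        exact absurd (hs z (by simp) hbz) (hzx.trans_le hxa).not_ge
    rw [hr, hl', hr']
    simpa using hbx.trans_le hxa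

theorem decreasesBetweenInversions_of_forall_descent {w : List α}
    (hw : ∀ p s : List α, ∀ x y : α, w = p ++ y :: x :: s → x < y →
      (∀ z ∈ s, x ≤ z → y ≤ z) ∧ (∀ z ∈ p, x < z → y < z)) : DecreasesBetweenInversions w := by
  intro x y z h hzx
  obtain ⟨r₁, r₂, rfl, h₁, h₂⟩ := List.append_sublist_iff.1 (show ([x] ++ [y, z]).Sublist w from h)
  obtain ⟨r₃, r₄, rfl, h₃, h₄⟩ := List.append_sublist_iff.1
    (show ([y] ++ [z]).Sublist r₂ from h₂)
  rw [List.singleton_sublist] at h₁ h₃ h₄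
  obtain ⟨p, m₁, rfl⟩ := List.append_of_mem h₁
  obtain ⟨m₂, s, rfl⟩ := List.append_of_mem h₄
  have := pairwise_of_forall_descent hw (m₁ ++ r₃ ++ m₂) p s x z (by simp) hzx
  rw [List.cons_append, List.pairwise_cons, List.pairwise_append] at this
  exact ⟨this.2.2.2 y (by simp [h₃]) z (by simp), this.1 y (by simp [h₃])⟩

/-! ### The content and the inversions of a word -/

/-- The words have the same letters with the same multiplicities and, for any two letters `a < b`
that are consecutive in the support, either both or neither have a `b` before an `a`. -/
def SameInvariants (u v : List α) : Prop :=
  u.Perm v ∧ ∀ a b, a < b → a ∈ u → b ∈ u → (∀ c ∈ u, a < c → b ≤ c) →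
    ([b, a].Sublist u ↔ [b, a].Sublist v)

theorem SameInvariants.refl (u : List α) : SameInvariants u u :=
  ⟨.refl _, fun _ _ _ _ _ _ => Iff.rfl⟩

theorem SameInvariants.symm {u v : List α} (h : SameInvariants u v) : SameInvariants v u :=
  ⟨h.1.symm, fun a b hab ha hb hc => (h.2 a b hab (h.1.mem_iff.2 ha) (h.1.mem_iff.2 hb)
    fun c hcu => hc c (h.1.mem_iff.1 hcu)).symm⟩

theorem SameInvariants.trans {u v w : List α} (h : SameInvariants u v) (h' : SameInvariants v w) :
    SameInvariants u w :=
  ⟨h.1.trans h'.1, fun a b hab ha hb hc => (h.2 a b hab ha hb hc).trans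
    (h'.2 a b hab (h.1.mem_iff.1 ha) (h.1.mem_iff.1 hb) fun c hcv => hc c (h.1.mem_iff.2 hcv))⟩

theorem SameInvariants.pair_sublist_iff {u v p : List α} (h : SameInvariants u v)
    (hp : ∀ x ∈ u, x ∈ p) {a b : α} (hab : a < b) (hc : ∀ c ∈ p, a < c → b ≤ c) :
    [b, a].Sublist u ↔ [b, a].Sublist v := by
  by_cases hu : a ∈ u ∧ b ∈ u
  · exact h.2 a b hab hu.1 hu.2 fun c hcu => hc c (hp c hcu)
  · constructor
    · exact fun hs => (hu ⟨hs.subset (by simp), hs.subset (by simp)⟩).elim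
    · exact fun hs => (hu ⟨h.1.mem_iff.2 (hs.subset (by simp)),
        h.1.mem_iff.2 (hs.subset (by simp))⟩).elim

theorem SameInvariants.append {u u' v v' : List α} (h : SameInvariants u u')
    (h' : SameInvariants v v') : SameInvariants (u ++ v) (u' ++ v') := by
  refine ⟨h.1.append h'.1, fun a b hab ha hb hc => ?_⟩
  rw [pair_sublist_append, pair_sublist_append, h.1.mem_iff, h'.1.mem_iff,
    h.pair_sublist_iff (p := u ++ v) (by simp +contextual) hab hc,
    h'.pair_sublist_iff (p := u ++ v) (by simp +contextual) hab hc]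

/-- Removing the common first letter `x` may create new consecutive letters `a < x < b`; then no
`b` precedes an `a` in either word. -/
theorem SameInvariants.of_cons {x : α} {u v : List α} (hu : DecreasesBetweenInversions (x :: u))
    (hv : DecreasesBetweenInversions (x :: v)) (h : SameInvariants (x :: u) (x :: v)) :
    SameInvariants u v := by
  refine ⟨h.1.cons_inv, fun a b hab ha hb hc => ?_⟩
  have key : ∀ w : List α, DecreasesBetweenInversions (x :: w) → a < x → b ≥ x →
      ¬ [b, a].Sublist w := fun w hw hax hxb hs =>
    (hw x b a (hs.cons_cons x) hax).2.not_ge hxb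
  by_cases hx : a < x ∧ x ≤ b
  · exact iff_of_false (key u hu hx.1 hx.2) (key v hv hx.1 hx.2)
  have hxb : b ≠ x := by rintro rfl; exact hx ⟨hab, le_rfl⟩
  have := h.2 a b hab (by simp [ha]) (by simp [hb]) fun c hcu hac => by
    rcases List.mem_cons.1 hcu with rfl | hcu
    · exact (not_le.1 fun hcb => hx ⟨hac, hcb⟩).le
    · exact hc c hcu hac
  simpa [List.cons_sublist_cons', hxb] using this

/-- If `x < y`, let `y₀` be the successor of `x` in the support. In `y :: v` a `y₀` precedes an `x`,
hence also in `x :: u`, so `x` occurs twice; but no letter smaller than `y` occurs twice after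
`y`. -/
theorem le_head_of_sameInvariants {x y : α} {u v : List α}
    (hv : DecreasesBetweenInversions (y :: v)) (h : SameInvariants (x :: u) (y :: v)) : y ≤ x := by
  by_contra! hxy
  have hxv : x ∈ v := List.mem_of_ne_of_mem hxy.ne (h.1.mem_iff.1 (by simp))
  obtain ⟨y₀, hy₀, hmin⟩ := ((y :: v).toFinset.filter (x < ·)).exists_min_image id
    ⟨y, by simp [hxy]⟩
  simp only [Finset.mem_filter, List.mem_toFinset, id] at hy₀ hmin
  have hinv : [y₀, x].Sublist (y :: v) := by
    by_cases hy : y₀ = y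
    · subst hy
      exact (List.singleton_sublist.2 hxv).cons_cons _
    · refine (pair_sublist_or (List.mem_of_ne_of_mem hy hy₀.1) hxv hy₀.2.ne').elim (·.cons _)
        fun hs => ?_
      have := (hv y x y₀ (hs.cons_cons y) (lt_of_le_of_ne (hmin y ⟨by simp, hxy⟩) hy)).1
      exact absurd this hy₀.2.not_gt
  have hinv' := (h.2 x y₀ hy₀.2 (by simp) (h.1.mem_iff.2 hy₀.1) fun c hcu hxc =>
    hmin c ⟨h.1.mem_iff.1 hcu, hxc⟩).2 hinv
  have hxu : x ∈ u := by
    rw [List.cons_sublist_cons'] at hinv'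
    rcases hinv' with hs | ⟨hs, -⟩
    · exact hs.subset (by simp)
    · exact absurd hs hy₀.2.ne'
  have hcount : 2 ≤ List.count x v := by
    have h₁ := h.1.count_eq x
    have h₂ := List.count_pos_iff.2 hxu
    rw [List.count_cons_self, List.count_cons_of_ne hxy.ne'] at h₁
    omega
  exact (hv y x x ((List.replicate_sublist_iff.2 hcount).cons_cons y) hxy).1.ne rfl

/-- The content and the inversions determine a word that decreases between inversions. -/
theorem eq_of_sameInvariants {u v : List α} (hu : DecreasesBetweenInversions u)
    (hv : DecreasesBetweenInversions v) (h : SameInvariants u v) : u = v := by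
  induction u generalizing v with
  | nil => exact h.1.nil_eq
  | cons x u ih =>
    rcases v with _ | ⟨y, v⟩
    · exact h.1.eq_nil
    · obtain rfl : x = y :=
        (le_head_of_sameInvariants hu h.symm).antisymm (le_head_of_sameInvariants hv h)
      rw [ih (hu.sublist (List.sublist_cons_self _ _)) (hv.sublist (List.sublist_cons_self _ _))
        (h.of_cons hu hv)]

/-! ### Contents of prefixes -/

theorem count_le_one_of_lt_mem {p p' : List α} (h : DecreasesBetweenInversions (p ++ p')) {y z : α}
    (hz : z ∈ p) (hyz : y < z) : p'.count y ≤ 1 := by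
  by_contra! hc
  exact (h z y y ((List.singleton_sublist.2 hz).append (List.replicate_sublist_iff.2 hc)) hyz).1.ne
    rfl

/-- A prefix contains all but at most one of the occurrences of every letter smaller than its
greatest letter, so the prefix with the greater maximum essentially dominates the other one. -/
theorem count_prefix_dichotomy {p p' q q' : List α} (hp : DecreasesBetweenInversions (p ++ p'))
    (hq : DecreasesBetweenInversions (q ++ q'))
    (h₁ : ∀ y, (p ++ p').count y ≤ (q ++ q').count y + 1)
    (h₂ : ∀ y, (q ++ q').count y ≤ (p ++ p').count y + 1) :
    (∀ y, p.count y ≤ q.count y + 2) ∨ ∀ y, q.count y ≤ p.count y + 2 := by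
  by_contra! h
  obtain ⟨⟨y, hy⟩, z, hz⟩ := h
  have h₁y := h₁ y
  have h₂z := h₂ z
  simp only [List.count_append] at h₁y h₂z
  rcases lt_trichotomy y z with hyz | rfl | hzy
  · have := count_le_one_of_lt_mem hq (List.count_pos_iff.1 (by omega : 0 < q.count z)) hyz
    omega
  · omega
  · have := count_le_one_of_lt_mem hp (List.count_pos_iff.1 (by omega : 0 < p.count y)) hzy
    omega

theorem sum_count_eq_length [Fintype α] (w : List α) : ∑ y, w.count y = w.length := by
  simpa using Multiset.sum_count_eq_card (s := Finset.univ) (m := (w : Multiset α)) (by simp)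

theorem count_le_of_forall_count_le [Fintype α] {p q : List α}
    (h : ∀ y, p.count y ≤ q.count y + 2) (hl : q.length ≤ p.length + 1) (y : α) :
    q.count y ≤ p.count y + (2 * Fintype.card α + 1) := by
  have h₁ : q.count y + 2 - p.count y ≤ ∑ z, (q.count z + 2 - p.count z) :=
    Finset.single_le_sum (f := fun z => q.count z + 2 - p.count z) (by simp) (Finset.mem_univ y)
  have h₂ : ∑ z, (q.count z + 2 - p.count z) + ∑ z, p.count z = ∑ z, (q.count z + 2) := by
    rw [← Finset.sum_add_distrib]
    exact Finset.sum_congr rfl fun z _ => Nat.sub_add_cancel (h z)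
  rw [Finset.sum_add_distrib, sum_count_eq_length, sum_count_eq_length] at h₂
  simp only [Finset.sum_const, Finset.card_univ, smul_eq_mul] at h₂
  omega

/-- Prefixes of nearly equal length of two words with nearly equal contents have nearly equal
contents, if both words decrease between inversions. -/
theorem abs_count_sub_count_le [Fintype α] {p p' q q' : List α}
    (hp : DecreasesBetweenInversions (p ++ p')) (hq : DecreasesBetweenInversions (q ++ q'))
    (h₁ : ∀ y, (p ++ p').count y ≤ (q ++ q').count y + 1)
    (h₂ : ∀ y, (q ++ q').count y ≤ (p ++ p').count y + 1)
    (hpq : p.length ≤ q.length + 1) (hqp : q.length ≤ p.length + 1) (y : α) :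
    |(q.count y : ℤ) - p.count y| ≤ 2 * Fintype.card α + 2 := by
  rw [abs_le]
  rcases count_prefix_dichotomy hp hq h₁ h₂ with h | h
  · have := h y
    have := count_le_of_forall_count_le h hqp y
    constructor <;> omega
  · have := h y
    have := count_le_of_forall_count_le h hpq y
    constructor <;> omega

end Words

/-! ### Quasi-ribbon words -/

theorem isQuasiRibbonWord_of_decreasesBetweenInversions {n : ℕ} {w : List (Fin n)}
    (hw : DecreasesBetweenInversions w) : IsQuasiRibbonWord w := by
  have hflat := List.flatten_splitBy (fun x y : Fin n => decide (x > y)) w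
  have hchain := List.isChain_getLast_head_splitBy (fun x y : Fin n => decide (x > y)) w
  unfold IsQuasiRibbonWord maximalColumns
  rw [List.isChain_iff_forall_rel_of_append_cons_cons] at hchain ⊢
  intro α β l₁ l₂ he x hx y hy
  obtain ⟨hα, hβ, hr⟩ := hchain he
  have hsub : (α ++ β).Sublist w := by
    rw [← hflat, he]
    simp
  have hw' := hw.sublist hsub
  by_contra hyx
  rw [not_le] at hyx
  simp only [gt_iff_lt, decide_eq_false_iff_not, not_lt] at hr
  rcases α with _ | ⟨x', α⟩
  · exact hα rfl
  obtain rfl : x' = x := by simpa using hx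
  rcases β.eq_nil_or_concat with rfl | ⟨β, y', rfl⟩
  · exact hβ rfl
  obtain rfl : y' = y := by simpa using hy
  -- The condition on three letters makes the border of the two columns a descent.
  rcases α.eq_nil_or_concat with rfl | ⟨α, a, rfl⟩
  · rcases β with _ | ⟨b, β⟩
    · simp at hr
      exact absurd hyx hr.not_gt
    · simp at hr
      exact absurd (hw' x' b y' (by simp) hyx).2 hr.not_gt
  · rcases β with _ | ⟨b, β⟩
    · simp at hr
      exact absurd (hw' x' a y' (by simp) hyx).1 hr.not_gt
    · simp at hr
      have h₁ := (hw' x' b y' (by simp) hyx).2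
      exact absurd (hw' x' a b (by simp) h₁).1 hr.not_gt

theorem decreasesBetweenInversions_of_isQuasiRibbonWord {n : ℕ} {w : List (Fin n)}
    (hw : IsQuasiRibbonWord w) : DecreasesBetweenInversions w := by
  unfold IsQuasiRibbonWord at hw
  have hne : ∀ c ∈ maximalColumns w, c ≠ [] := fun c hc => List.ne_nil_of_mem_splitBy hc
  have hdec : ∀ c ∈ maximalColumns w, c.Pairwise (· > ·) := fun c hc =>
    List.isChain_iff_pairwise.1 (by simpa using List.isChain_of_mem_splitBy hc)
  rw [← List.flatten_splitBy (fun x y : Fin n => decide (x > y)) w]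
  change DecreasesBetweenInversions (maximalColumns w).flatten
  generalize maximalColumns w = cols at hw hne hdec
  refine decreasesBetweenInversions_flatten hdec ?_
  have hle : ∀ c : List (Fin n), c.Pairwise (· > ·) → ∀ h : c ≠ [], ∀ x ∈ c,
      c.getLast h ≤ x ∧ x ≤ c.head h := fun c hc h x hx =>
    ⟨(hc.imp (S := (· ≥ ·)) fun h => h.le).rel_getLast hx,
      (hc.imp (S := (· ≥ ·)) fun h => h.le).rel_head hx⟩
  -- On nonempty columns the relation between letters is transitive.
  let R : List (Fin n) → List (Fin n) → Prop := fun c d => d ≠ [] ∧ ∀ x ∈ c, ∀ y ∈ d, x ≤ y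
  have : Trans R R R := ⟨fun {c d e} hcd hde => ⟨hde.1, fun x hx z hz =>
    (hcd.2 x hx _ (List.head_mem hcd.1)).trans (hde.2 _ (List.head_mem hcd.1) z hz)⟩⟩
  have hR : cols.IsChain R := by
    rw [List.isChain_iff_forall_rel_of_append_cons_cons] at hw ⊢
    intro c d l₁ l₂ he
    have hc : c ∈ cols := by simp [he]
    have hd : d ∈ cols := by simp [he]
    refine ⟨hne d hd, fun x hx y hy => ?_⟩
    calc
      x ≤ c.head (hne c hc) := (hle c (hdec c hc) (hne c hc) x hx).2
      _ ≤ d.getLast (hne d hd) := hw he _ (List.head_mem_head? _) _ (List.getLast_mem_getLast? _)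
      _ ≤ y := (hle d (hdec d hd) (hne d hd) y hy).1
  exact (List.isChain_iff_pairwise.1 hR).imp And.right

theorem isQuasiRibbonWord_iff {n : ℕ} {w : List (Fin n)} :
    IsQuasiRibbonWord w ↔ DecreasesBetweenInversions w :=
  ⟨decreasesBetweenInversions_of_isQuasiRibbonWord,
    isQuasiRibbonWord_of_decreasesBetweenInversions⟩

/-! ### The swap lemma in the hypoplactic monoid -/

variable {n : ℕ}

/-- Two words are congruent if they represent the same element of the hypoplactic monoid. -/
def WordCongr (u v : List (Fin n)) : Prop :=
  wordValue (PresentedMonoid.of (HypoplacticRel n)) u =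
    wordValue (PresentedMonoid.of (HypoplacticRel n)) v

namespace WordCongr

theorem refl (u : List (Fin n)) : WordCongr u u := rfl

theorem symm {u v : List (Fin n)} (h : WordCongr u v) : WordCongr v u := Eq.symm h

theorem trans {u v w : List (Fin n)} (h : WordCongr u v) (h' : WordCongr v w) : WordCongr u w :=
  Eq.trans h h'

instance : Trans (WordCongr (n := n)) (WordCongr (n := n)) (WordCongr (n := n)) := ⟨trans⟩

theorem append_append {u v : List (Fin n)} (h : WordCongr u v) (p s : List (Fin n)) :
    WordCongr (p ++ u ++ s) (p ++ v ++ s) := by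
  unfold WordCongr wordValue at *
  simp only [List.map_append, List.prod_append, h]

end WordCongr

theorem wordValue_eq_mk (w : List (Fin n)) :
    wordValue (PresentedMonoid.of (HypoplacticRel n)) w =
      PresentedMonoid.mk (HypoplacticRel n) (FreeMonoid.ofList w) := by
  induction w with
  | nil => rfl
  | cons a w ih =>
    rw [FreeMonoid.ofList_cons, map_mul, ← ih]
    rfl

theorem wordCongr_iff {u v : List (Fin n)} :
    WordCongr u v ↔ conGen (HypoplacticRel n) (FreeMonoid.ofList u) (FreeMonoid.ofList v) := by
  rw [WordCongr, wordValue_eq_mk, wordValue_eq_mk, PresentedMonoid.mk_eq_mk_iff]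

theorem WordCongr.of_rel {u v : List (Fin n)}
    (h : HypoplacticRel n (FreeMonoid.ofList u) (FreeMonoid.ofList v)) : WordCongr u v :=
  wordCongr_iff.2 (ConGen.Rel.of _ _ h)

/-- The commutation rules of the hypoplactic monoid with witnesses at distance at most `k`. In
`right` and `left` a letter elsewhere in the word makes two adjacent letters commute; in
`both₁` and `both₂` two pairs of adjacent letters commute at the same time. For `k = 0` these are
the defining relations. -/
structure SwapUpTo (n k : ℕ) : Prop where
  right : ∀ {x y e : Fin n} (s : List (Fin n)), s.length ≤ k → x ≤ e → e < y →
    WordCongr (x :: y :: s ++ [e]) (y :: x :: s ++ [e])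
  left : ∀ {b a c : Fin n} (s : List (Fin n)), s.length ≤ k → a < b → b ≤ c →
    WordCongr (b :: s ++ [a, c]) (b :: s ++ [c, a])
  both₁ : ∀ {x y e t : Fin n} (s : List (Fin n)), s.length ≤ k → x ≤ e → e < y → y ≤ t →
    WordCongr (y :: x :: s ++ [t, e]) (x :: y :: s ++ [e, t])
  both₂ : ∀ {a b c d : Fin n} (s : List (Fin n)), s.length ≤ k → a < b → b ≤ c → c < d →
    WordCongr (b :: d :: s ++ [a, c]) (d :: b :: s ++ [c, a])

theorem swapUpTo_zero : SwapUpTo n 0 where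
  right s hs h h' := by
    rw [List.length_eq_zero_iff.1 (Nat.le_zero.1 hs)]
    exact .of_rel (.knuth₁ _ _ _ h h')
  left s hs h h' := by
    rw [List.length_eq_zero_iff.1 (Nat.le_zero.1 hs)]
    exact .of_rel (.knuth₂ _ _ _ h h')
  both₁ s hs h h' h'' := by
    rw [List.length_eq_zero_iff.1 (Nat.le_zero.1 hs)]
    exact .of_rel (.quartic₁ _ _ _ _ h h' h'')
  both₂ s hs h h' h'' := by
    rw [List.length_eq_zero_iff.1 (Nat.le_zero.1 hs)]
    exact .of_rel (.quartic₂ _ _ _ _ h h' h'')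

/-- A congruence between factors of two words. -/
theorem WordCongr.factor {u v w w' : List (Fin n)} (h : WordCongr u v) (p s : List (Fin n))
    (hw : w = p ++ u ++ s) (hw' : w' = p ++ v ++ s) : WordCongr w w' := by
  subst hw hw'
  exact h.append_append p s

namespace SwapUpTo

variable {k : ℕ}

theorem right_succ (H : SwapUpTo n k) {x y e : Fin n} (s : List (Fin n)) (hs : s.length ≤ k + 1)
    (hxe : x ≤ e) (hey : e < y) : WordCongr (x :: y :: s ++ [e]) (y :: x :: s ++ [e]) := by
  rcases s.eq_nil_or_concat with rfl | ⟨s, t, rfl⟩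
  · exact H.right [] (by simp) hxe hey
  have hs' : s.length ≤ k := by simpa using hs
  rcases le_or_gt y t with hyt | hty
  · calc
      WordCongr _ (x :: y :: s ++ [e, t]) :=
        (H.left s hs' hey hyt).symm.factor [x] [] (by simp) (by simp)
      WordCongr _ (y :: x :: s ++ [t, e]) :=
        (H.both₁ s hs' hxe hey hyt).symm
      WordCongr _ _ := (WordCongr.refl (y :: x :: s ++ [t, e])).factor [] [] (by simp) (by simp)
  rcases le_or_gt x t with hxt | htx
  · exact (H.right s hs' hxt hty).factor [] [e] (by simp) (by simp)
  · calc
      WordCongr _ (y :: x :: s ++ [e, t]) :=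
        (H.both₂ s hs' htx hxe hey).factor [] [] (by simp) (by simp)
      WordCongr _ _ :=
        (H.left s hs' htx hxe).symm.factor [y] [] (by simp) (by simp)

theorem left_succ (H : SwapUpTo n k) {b a c : Fin n} (s : List (Fin n)) (hs : s.length ≤ k + 1)
    (hab : a < b) (hbc : b ≤ c) : WordCongr (b :: s ++ [a, c]) (b :: s ++ [c, a]) := by
  rcases s with _ | ⟨r, s⟩
  · exact H.left [] (by simp) hab hbc
  have hs' : s.length ≤ k := by simpa using hs
  rcases le_or_gt r a with hra | har
  · calc
      WordCongr _ (r :: b :: s ++ [a, c]) :=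
        (H.right s hs' hra hab).symm.factor [] [c] (by simp) (by simp)
      WordCongr _ (b :: r :: s ++ [c, a]) := (H.both₁ s hs' hra hab hbc).symm
      WordCongr _ _ := (WordCongr.refl (b :: r :: s ++ [c, a])).factor [] [] (by simp) (by simp)
  rcases le_or_gt r c with hrc | hcr
  · exact (H.left s hs' har hrc).factor [b] [] (by simp) (by simp)
  · calc
      WordCongr _ (r :: b :: s ++ [c, a]) :=
        (H.both₂ s hs' hab hbc hcr).factor [] [] (by simp) (by simp)
      WordCongr _ _ :=
        (H.right s hs' hbc hcr).symm.factor [] [a] (by simp) (by simp)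

/-- A letter `q ≥ b` moves to the left across letters smaller than `b`, up to a letter `b`. -/
theorem left_move_large (H : SwapUpTo n k) {b q : Fin n} (l : List (Fin n)) (hl : l.length ≤ k + 1)
    (hlb : ∀ z ∈ l, z < b) (hbq : b ≤ q) : WordCongr (b :: l ++ [q]) (b :: q :: l) := by
  induction l using List.reverseRecOn with
  | nil => exact .refl _
  | append_singleton l z ih =>
    have hl' : l.length ≤ k := by simpa using hl
    calc
      WordCongr _ (b :: l ++ [q, z]) :=
        (H.left l hl' (hlb z (by simp)) hbq).factor [] [] (by simp) (by simp)
      WordCongr _ _ := (ih (by omega) fun z hz => hlb z (by simp [hz])).factor [] [z]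
        (by simp) (by simp)

/-- A letter `q < b` moves to the left across letters at least `b`, up to a letter `b`. -/
theorem left_move_small (H : SwapUpTo n k) {b q : Fin n} (l : List (Fin n)) (hl : l.length ≤ k + 1)
    (hlb : ∀ z ∈ l, b ≤ z) (hbq : q < b) : WordCongr (b :: l ++ [q]) (b :: q :: l) := by
  induction l using List.reverseRecOn with
  | nil => exact .refl _
  | append_singleton l z ih =>
    have hl' : l.length ≤ k := by simpa using hl
    calc
      WordCongr _ (b :: l ++ [q, z]) :=
        (H.left l hl' hbq (hlb z (by simp))).symm.factor [] [] (by simp) (by simp)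
      WordCongr _ _ := (ih (by omega) fun z hz => hlb z (by simp [hz])).factor [] [z]
        (by simp) (by simp)

/-- If the letters of `s` permit neither exchange, they lie below `x` or above `t`. Then the last
one is below `x` or some letter above `t` exists, and this letter can be moved out of `s`, across the
exchanged pair, on either side of the congruence. -/
theorem both₁_succ (H : SwapUpTo n k) {x y e t : Fin n} (s : List (Fin n)) (hs : s.length ≤ k + 1)
    (hxe : x ≤ e) (hey : e < y) (hyt : y ≤ t) :
    WordCongr (y :: x :: s ++ [t, e]) (x :: y :: s ++ [e, t]) := by
  -- A letter of `s` between `x` and `t` is itself a witness for one of the two swaps.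
  by_cases h₁ : ∃ r ∈ s, x ≤ r ∧ r < y
  · obtain ⟨r, hr, hxr, hry⟩ := h₁
    obtain ⟨s₁, s₂, rfl⟩ := List.append_of_mem hr
    simp only [List.length_append, List.length_cons] at hs
    calc
      WordCongr _ (x :: y :: (s₁ ++ r :: s₂) ++ [t, e]) :=
        (H.right s₁ (by omega) hxr hry).symm.factor [] (s₂ ++ [t, e]) (by simp) (by simp)
      WordCongr _ _ := (H.left_succ (s₁ ++ r :: s₂) (by simp; omega) hey hyt).symm.factor [x] []
        (by simp) (by simp)
  by_cases h₂ : ∃ r ∈ s, e < r ∧ r ≤ t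
  · obtain ⟨r, hr, her, hrt⟩ := h₂
    obtain ⟨s₁, s₂, rfl⟩ := List.append_of_mem hr
    simp only [List.length_append, List.length_cons] at hs
    calc
      WordCongr _ (y :: x :: (s₁ ++ r :: s₂) ++ [e, t]) :=
        (H.left s₂ (by omega) her hrt).symm.factor (y :: x :: s₁) [] (by simp) (by simp)
      WordCongr _ _ := (H.right_succ (s₁ ++ r :: s₂) (by simp; omega) hxe hey).symm.factor [] [t]
        (by simp) (by simp)
  have hlow : ∀ r ∈ s, r ≤ t → r < x := fun r hr hrt => by
    by_contra hxr
    rcases lt_or_ge r y with hry | hyr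
    · exact h₁ ⟨r, hr, not_lt.1 hxr, hry⟩
    · exact h₂ ⟨r, hr, hey.trans_le hyr, hrt⟩
  clear h₁ h₂
  have hxy : x < y := hxe.trans_lt hey
  rcases s.forall_or_exists_first_not (· ≤ t) with h | ⟨l, q, s', rfl, hl, hq⟩
  · -- All letters of `s` are smaller than `x`; the last one moves out of the way.
    rcases s.eq_nil_or_concat with rfl | ⟨s, q, rfl⟩
    · exact H.both₁ [] (by simp) hxe hey hyt
    have hqx : q < x := hlow q (by simp) (h q (by simp))
    have hs' : s.length ≤ k := by simpa using hs
    calc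
      WordCongr _ (y :: x :: s ++ [t, q, e]) :=
        (H.right [] (by simp) (hqx.le.trans hxe) (hey.trans_le hyt)).factor (y :: x :: s) []
          (by simp) (by simp)
      WordCongr _ (y :: x :: s ++ [t, e, q]) :=
        (H.left_succ (s ++ [t]) (by simpa using hs') hqx hxe).factor [y] [] (by simp) (by simp)
      WordCongr _ (x :: y :: s ++ [e, t, q]) :=
        (H.both₁ s hs' hxe hey hyt).factor [] [q] (by simp) (by simp)
      WordCongr _ (x :: y :: s ++ [e, q, t]) :=
        (H.left [] (by simp) (hqx.trans_le hxe) (hey.le.trans hyt)).symm.factor (x :: y :: s) []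
          (by simp) (by simp)
      WordCongr _ _ :=
        (H.left_succ (y :: s) (by simpa using hs') hqx hxe).symm.factor [] [t] (by simp) (by simp)
  · -- The first letter `q > t` moves to the left end of `s` and then out of the way.
    have htq : t < q := not_le.1 hq
    have hyq : y < q := hyt.trans_lt htq
    have hlx : ∀ z ∈ l, z < x := fun z hz => hlow z (by simp [hz]) (hl z hz)
    simp only [List.length_append, List.length_cons] at hs
    calc
      WordCongr _ (y :: x :: q :: (l ++ s') ++ [t, e]) :=
        (H.left_move_large l (by omega) hlx (hxy.le.trans hyq.le)).factor [y] (s' ++ [t, e])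
          (by simp) (by simp)
      WordCongr _ (y :: q :: x :: (l ++ s') ++ [t, e]) :=
        (H.left [] (by simp) hxy hyq.le).factor [] ((l ++ s') ++ [t, e]) (by simp) (by simp)
      WordCongr _ (q :: y :: x :: (l ++ s') ++ [t, e]) :=
        (H.right_succ (x :: (l ++ s')) (by simp; omega) hyt htq).factor [] [e] (by simp) (by simp)
      WordCongr _ (q :: x :: y :: (l ++ s') ++ [e, t]) :=
        (H.both₁ (l ++ s') (by simp; omega) hxe hey hyt).factor [q] [] (by simp) (by simp)
      WordCongr _ (x :: q :: y :: (l ++ s') ++ [e, t]) :=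
        (H.right [] (by simp) hxy.le hyq).symm.factor [] ((l ++ s') ++ [e, t])
          (by simp) (by simp)
      WordCongr _ (x :: y :: q :: (l ++ s') ++ [e, t]) :=
        (H.right_succ (l ++ s' ++ [e]) (by simp; omega) hyt htq).symm.factor [x] []
          (by simp) (by simp)
      WordCongr _ _ :=
        (H.left_move_large l (by omega) (fun z hz => (hlx z hz).trans hxy) hyq.le).symm.factor
          [x] (s' ++ [e, t]) (by simp) (by simp)

/-- If the letters of `s` permit neither exchange, they are at most `a` or at least `d`, and one of
them can be moved out of `s`, as for `both₁_succ`. -/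
theorem both₂_succ (H : SwapUpTo n k) {a b c d : Fin n} (s : List (Fin n)) (hs : s.length ≤ k + 1)
    (hab : a < b) (hbc : b ≤ c) (hcd : c < d) :
    WordCongr (b :: d :: s ++ [a, c]) (d :: b :: s ++ [c, a]) := by
  -- A letter of `s` strictly between `a` and `d` is itself a witness for one of the two swaps.
  by_cases h₁ : ∃ r ∈ s, b ≤ r ∧ r < d
  · obtain ⟨r, hr, hbr, hrd⟩ := h₁
    obtain ⟨s₁, s₂, rfl⟩ := List.append_of_mem hr
    simp only [List.length_append, List.length_cons] at hs
    calc
      WordCongr _ (d :: b :: (s₁ ++ r :: s₂) ++ [a, c]) :=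
        (H.right s₁ (by omega) hbr hrd).factor [] (s₂ ++ [a, c]) (by simp) (by simp)
      WordCongr _ _ := (H.left_succ (s₁ ++ r :: s₂) (by simp; omega) hab hbc).factor [d] []
        (by simp) (by simp)
  by_cases h₂ : ∃ r ∈ s, a < r ∧ r ≤ c
  · obtain ⟨r, hr, har, hrc⟩ := h₂
    obtain ⟨s₁, s₂, rfl⟩ := List.append_of_mem hr
    simp only [List.length_append, List.length_cons] at hs
    calc
      WordCongr _ (b :: d :: (s₁ ++ r :: s₂) ++ [c, a]) :=
        (H.left s₂ (by omega) har hrc).factor (b :: d :: s₁) [] (by simp) (by simp)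
      WordCongr _ _ := (H.right_succ (s₁ ++ r :: s₂) (by simp; omega) hbc hcd).factor [] [a]
        (by simp) (by simp)
  have hlow : ∀ r ∈ s, a < r → d ≤ r := fun r hr har => by
    by_contra hdr
    rcases lt_or_ge r b with hrb | hbr
    · exact h₂ ⟨r, hr, har, (hrb.trans_le hbc).le⟩
    · exact h₁ ⟨r, hr, hbr, not_le.1 hdr⟩
  clear h₁ h₂
  have hbd : b < d := hbc.trans_lt hcd
  rcases s.forall_or_exists_first_not (a < ·) with h | ⟨l, r, s', rfl, hl, hr⟩
  · -- All letters of `s` are at least `d`; the last one moves out of the way.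
    rcases s.eq_nil_or_concat with rfl | ⟨s, q, rfl⟩
    · exact H.both₂ [] (by simp) hab hbc hcd
    have hdq : d ≤ q := hlow q (by simp) (h q (by simp))
    have hac : a < c := hab.trans_le hbc
    have hcq : c < q := hcd.trans_le hdq
    have hs' : s.length ≤ k := by simpa using hs
    calc
      WordCongr _ (b :: d :: s ++ [a, q, c]) :=
        (H.right [] (by simp) hac.le hcq).symm.factor (b :: d :: s) []
          (by simp) (by simp)
      WordCongr _ (b :: d :: s ++ [a, c, q]) :=
        (H.left_succ (s ++ [a]) (by simpa using hs') hcd hdq).symm.factor [b] []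
          (by simp) (by simp)
      WordCongr _ (d :: b :: s ++ [c, a, q]) :=
        (H.both₂ s hs' hab hbc hcd).factor [] [q] (by simp) (by simp)
      WordCongr _ (d :: b :: s ++ [c, q, a]) :=
        (H.left [] (by simp) hac hcq.le).factor (d :: b :: s) []
          (by simp) (by simp)
      WordCongr _ _ :=
        (H.left_succ (b :: s) (by simpa using hs') hcd hdq).factor [] [a] (by simp) (by simp)
  · -- The first letter `r ≤ a` moves to the left end of `s` and then out of the way.
    have hra : r ≤ a := not_lt.1 hr
    have hrb : r < b := hra.trans_lt hab
    have hld : ∀ z ∈ l, d ≤ z := fun z hz => hlow z (by simp [hz]) (hl z hz)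
    simp only [List.length_append, List.length_cons] at hs
    calc
      WordCongr _ (b :: d :: r :: (l ++ s') ++ [a, c]) :=
        (H.left_move_small l (by omega) hld (hrb.trans hbd)).factor [b] (s' ++ [a, c])
          (by simp) (by simp)
      WordCongr _ (b :: r :: d :: (l ++ s') ++ [a, c]) :=
        (H.left [] (by simp) hrb hbd.le).symm.factor [] ((l ++ s') ++ [a, c])
          (by simp) (by simp)
      WordCongr _ (r :: b :: d :: (l ++ s') ++ [a, c]) :=
        (H.right_succ (d :: (l ++ s')) (by simp; omega) hra hab).symm.factor [] [c]
          (by simp) (by simp)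
      WordCongr _ (r :: d :: b :: (l ++ s') ++ [c, a]) :=
        (H.both₂ (l ++ s') (by simp; omega) hab hbc hcd).factor [r] [] (by simp) (by simp)
      WordCongr _ (d :: r :: b :: (l ++ s') ++ [c, a]) :=
        (H.right [] (by simp) hrb.le hbd).factor [] ((l ++ s') ++ [c, a])
          (by simp) (by simp)
      WordCongr _ (d :: b :: r :: (l ++ s') ++ [c, a]) :=
        (H.right_succ (l ++ s' ++ [c]) (by simp; omega) hra hab).factor [d] []
          (by simp) (by simp)
      WordCongr _ _ :=
        (H.left_move_small l (by omega) (fun z hz => hbd.le.trans (hld z hz)) hrb).symm.factor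
          [d] (s' ++ [c, a]) (by simp) (by simp)

theorem succ (H : SwapUpTo n k) : SwapUpTo n (k + 1) :=
  ⟨H.right_succ, H.left_succ, H.both₁_succ, H.both₂_succ⟩

end SwapUpTo

theorem swapUpTo (n k : ℕ) : SwapUpTo n k := by
  induction k with
  | zero => exact swapUpTo_zero
  | succ k ih => exact ih.succ

/-- Adjacent letters `x < y` commute if a letter `z` with `x ≤ z < y` occurs to their right. -/
theorem wordCongr_swap_of_mem_right {x y z : Fin n} (p : List (Fin n)) {s : List (Fin n)}
    (hz : z ∈ s) (hxz : x ≤ z) (hzy : z < y) :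
    WordCongr (p ++ y :: x :: s) (p ++ x :: y :: s) := by
  obtain ⟨s₁, s₂, rfl⟩ := List.append_of_mem hz
  exact ((swapUpTo n _).right s₁ le_rfl hxz hzy).symm.factor p s₂ (by simp) (by simp)

/-- Adjacent letters `x < y` commute if a letter `z` with `x < z ≤ y` occurs to their left. -/
theorem wordCongr_swap_of_mem_left {x y z : Fin n} {p : List (Fin n)} (s : List (Fin n))
    (hz : z ∈ p) (hxz : x < z) (hzy : z ≤ y) :
    WordCongr (p ++ y :: x :: s) (p ++ x :: y :: s) := by
  obtain ⟨p₁, p₂, rfl⟩ := List.append_of_mem hz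
  exact ((swapUpTo n _).left p₂ le_rfl hxz hzy).symm.factor p₁ s (by simp) (by simp)

/-! ### The invariants characterise the congruence -/

/-- The number of inversions of a word. -/
def inversionCount {α : Type*} [LinearOrder α] : List α → ℕ
  | [] => 0
  | a :: l => l.countP (· < a) + inversionCount l

theorem inversionCount_swap_lt {α : Type*} [LinearOrder α] {x y : α} (hxy : x < y)
    (p s : List α) : inversionCount (p ++ x :: y :: s) < inversionCount (p ++ y :: x :: s) := by
  induction p with
  | nil => simp [inversionCount, hxy, hxy.le]; omega
  | cons a p ih =>
    have : (p ++ x :: y :: s).countP (· < a) = (p ++ y :: x :: s).countP (· < a) :=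
      ((List.Perm.swap y x s).append_left p).countP_eq _
    simp only [List.cons_append, inversionCount, this]
    omega

theorem exists_wordCongr_decreasesBetweenInversions (w : List (Fin n)) :
    ∃ v, WordCongr w v ∧ DecreasesBetweenInversions v := by
  induction hk : inversionCount w using Nat.strong_induction_on generalizing w with
  | _ k ih =>
  subst hk
  by_cases h : ∃ (p s : List (Fin n)) (x y : Fin n), w = p ++ y :: x :: s ∧ x < y ∧
      WordCongr (p ++ y :: x :: s) (p ++ x :: y :: s)
  · obtain ⟨p, s, x, y, rfl, hxy, hc⟩ := h
    obtain ⟨v, hv, hv'⟩ := ih _ (inversionCount_swap_lt hxy p s) _ rfl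
    exact ⟨v, hc.trans hv, hv'⟩
  · refine ⟨w, .refl w, decreasesBetweenInversions_of_forall_descent fun p s x y hw hxy => ?_⟩
    constructor
    · intro z hz hxz
      by_contra hyz
      exact h ⟨p, s, x, y, hw, hxy, wordCongr_swap_of_mem_right p hz hxz (not_le.1 hyz)⟩
    · intro z hz hxz
      by_contra hyz
      exact h ⟨p, s, x, y, hw, hxy, wordCongr_swap_of_mem_left s hz hxz (not_lt.1 hyz)⟩

/-- `SameInvariants` as a congruence on the free monoid. -/
def invariantsCon (n : ℕ) : Con (FreeMonoid (Fin n)) where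
  r u v := SameInvariants u.toList v.toList
  iseqv := ⟨fun u => .refl u.toList, .symm, .trans⟩
  mul' h h' := by
    simpa only [FreeMonoid.toList_mul] using h.append h'

theorem sameInvariants_of_rel {u v : FreeMonoid (Fin n)} (h : HypoplacticRel n u v) :
    SameInvariants u.toList v.toList := by
  cases h with
  | knuth₁ a b c hab hbc =>
    refine ⟨.swap _ _ _, fun p q hpq hp hq hc => ?_⟩
    simp [FreeMonoid.toList_mul, List.cons_sublist_cons'] at *
    grind
  | knuth₂ a b c hab hbc =>
    refine ⟨.cons _ (.swap _ _ _), fun p q hpq hp hq hc => ?_⟩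
    simp [FreeMonoid.toList_mul, List.cons_sublist_cons'] at *
    grind
  | quartic₁ a b c d hab hbc hcd =>
    refine ⟨((List.Perm.swap _ _ _).trans (.cons _ (.cons _ (.swap _ _ _)))),
      fun p q hpq hp hq hc => ?_⟩
    simp [FreeMonoid.toList_mul, List.cons_sublist_cons'] at *
    grind
  | quartic₂ a b c d hab hbc hcd =>
    refine ⟨((List.Perm.swap _ _ _).trans (.cons _ (.cons _ (.swap _ _ _)))),
      fun p q hpq hp hq hc => ?_⟩
    simp [FreeMonoid.toList_mul, List.cons_sublist_cons'] at *
    grind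

theorem WordCongr.sameInvariants {u v : List (Fin n)} (h : WordCongr u v) :
    SameInvariants u v := by
  have : conGen (HypoplacticRel n) ≤ invariantsCon n :=
    Con.conGen_le.2 fun _ _ => sameInvariants_of_rel
  exact this (wordCongr_iff.1 h)

theorem wordCongr_iff_sameInvariants {u v : List (Fin n)} :
    WordCongr u v ↔ SameInvariants u v := by
  refine ⟨WordCongr.sameInvariants, fun h => ?_⟩
  obtain ⟨u', hu, hu'⟩ := exists_wordCongr_decreasesBetweenInversions u
  obtain ⟨v', hv, hv'⟩ := exists_wordCongr_decreasesBetweenInversions v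
  obtain rfl := eq_of_sameInvariants hu' hv'
    ((hu.sameInvariants.symm.trans h).trans hv.sameInvariants)
  exact hu.trans hv.symm

/-! ### Word functions computed by finite automata -/

section Automata

variable {α β σ τ : Type*}

/-- The value of `f` after reading one more letter depends only on that letter and on the value
before it. -/
def Updatable (f : List α → σ) : Prop :=
  ∀ u v a, f u = f v → f (u ++ [a]) = f (v ++ [a])

/-- The function `f` on words is computed by a finite automaton reading from left to right. -/
structure FiniteState (f : List α → σ) : Prop where
  finite : (Set.range f).Finite
  updatable : Updatable f

theorem Updatable.append {f : List α → σ} (h : Updatable f) {u v : List α} (huv : f u = f v)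
    (w : List α) : f (u ++ w) = f (v ++ w) := by
  induction w using List.reverseRecOn with
  | nil => simpa using huv
  | append_singleton w a ih => simpa using h _ _ a ih

theorem FiniteState.isRegular {f : List α → σ} (h : FiniteState f) {L : Language α}
    (hL : ∀ u v, f u = f v → u ∈ L → v ∈ L) : L.IsRegular := by
  refine .of_finite_range_leftQuotient ?_
  have : Function.FactorsThrough L.leftQuotient f := by
    intro u v huv
    ext w
    exact ⟨hL _ _ (h.updatable.append huv w), hL _ _ (h.updatable.append huv.symm w)⟩
  obtain ⟨e, he⟩ := (Function.factorsThrough_iff _).1 this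
  rw [he, Set.range_comp]
  exact h.finite.image e

theorem FiniteState.prodMk {f : List α → σ} {g : List α → τ} (hf : FiniteState f)
    (hg : FiniteState g) : FiniteState fun w => (f w, g w) where
  finite := (hf.finite.prod hg.finite).subset (by
    rintro _ ⟨w, rfl⟩
    exact ⟨⟨w, rfl⟩, ⟨w, rfl⟩⟩)
  updatable u v a h := by
    rw [Prod.mk.injEq] at h
    exact Prod.ext (hf.updatable u v a h.1) (hg.updatable u v a h.2)

theorem Updatable.comp_filterMap {f : List β → σ} (hf : Updatable f) (p : α → Option β) :
    Updatable fun w : List α => f (w.filterMap p) := by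
  intro u v a h
  simpa only [List.filterMap_append] using hf.append h _

theorem FiniteState.comp_filterMap {f : List β → σ} (hf : FiniteState f) (p : α → Option β) :
    FiniteState fun w : List α => f (w.filterMap p) where
  finite := hf.finite.subset (by rintro _ ⟨w, rfl⟩; exact ⟨_, rfl⟩)
  updatable := hf.updatable.comp_filterMap p

/-- The subsequences of length at most `k` of a word. -/
def shortSublists (k : ℕ) (w : List α) : Set (List α) :=
  {l | l.length ≤ k ∧ l.Sublist w}

theorem sublist_iff_of_shortSublists_eq {k : ℕ} {u v : List α}
    (h : shortSublists k u = shortSublists k v) (l : List α) (hl : l.length ≤ k) :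
    l.Sublist u ↔ l.Sublist v := by
  have := Set.ext_iff.1 h l
  simpa [shortSublists, hl] using this

theorem mem_shortSublists_append_singleton {k : ℕ} {w : List α} {a : α} {l : List α} :
    l ∈ shortSublists k (w ++ [a]) ↔
      l ∈ shortSublists k w ∨ ∃ l' ∈ shortSublists k w, l = l' ++ [a] ∧ l.length ≤ k := by
  simp only [shortSublists, Set.mem_ofPred_eq]
  constructor
  · rintro ⟨hl, h⟩
    obtain ⟨l₁, l₂, rfl, h₁, h₂⟩ := List.sublist_append_iff.1 h
    rcases List.sublist_singleton.1 h₂ with rfl | rfl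
    · exact .inl ⟨hl, by simpa using h₁⟩
    · exact .inr ⟨l₁, ⟨by simp at hl; omega, h₁⟩, rfl, hl⟩
  · rintro (⟨hl, h⟩ | ⟨l', ⟨-, h⟩, rfl, hl⟩)
    · exact ⟨hl, h.trans (List.sublist_append_left _ _)⟩
    · exact ⟨hl, h.append (.refl _)⟩

theorem finiteState_shortSublists [Finite α] (k : ℕ) :
    FiniteState (shortSublists (α := α) k) where
  finite := (List.finite_length_le α k).finite_subsets.subset (by
    rintro _ ⟨w, rfl⟩
    exact fun l hl => hl.1)
  updatable u v a h := by
    ext l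
    rw [mem_shortSublists_append_singleton, mem_shortSublists_append_singleton, h]

open Classical in
/-- The value of `g`, as long as `g` has stayed in `B` on all prefixes. -/
noncomputable def trackWithin (B : Set σ) (g : List α → σ) (w : List α) : Option σ :=
  if ∀ p, p <+: w → g p ∈ B then some (g w) else none

theorem trackWithin_eq_some {B : Set σ} {g : List α → σ} {w : List α} {s : σ} :
    trackWithin B g w = some s ↔ (∀ p, p <+: w → g p ∈ B) ∧ g w = s := by
  unfold trackWithin
  split_ifs with h
  · exact ⟨fun hs => ⟨h, Option.some.inj hs⟩, fun hs => congrArg some hs.2⟩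
  · exact iff_of_false nofun fun hs => h hs.1

theorem trackWithin_append_singleton {B : Set σ} {g : List α → σ} {w : List α} {a : α} {s : σ} :
    trackWithin B g (w ++ [a]) = some s ↔
      (∃ t, trackWithin B g w = some t) ∧ g (w ++ [a]) ∈ B ∧ g (w ++ [a]) = s := by
  simp only [trackWithin_eq_some, List.prefix_concat_iff]
  constructor
  · rintro ⟨h, rfl⟩
    exact ⟨⟨g w, fun p hp => h p (.inr hp), rfl⟩, h _ (.inl rfl), rfl⟩
  · rintro ⟨⟨t, h, -⟩, h', rfl⟩
    refine ⟨fun p hp => ?_, rfl⟩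
    rcases hp with rfl | hp
    exacts [h', h p hp]

theorem finiteState_trackWithin {B : Set σ} (hB : B.Finite) {g : List α → σ} (hg : Updatable g) :
    FiniteState (trackWithin B g) where
  finite := ((hB.image some).insert none).subset (by
    rintro _ ⟨w, rfl⟩
    rcases h : trackWithin B g w with _ | s
    · exact Set.mem_insert _ _
    · obtain ⟨h₁, rfl⟩ := trackWithin_eq_some.1 h
      exact .inr ⟨_, h₁ w (List.prefix_refl w), rfl⟩)
  updatable u v a h := by
    ext s
    rw [trackWithin_append_singleton, trackWithin_append_singleton, h]
    refine and_congr_right fun ⟨t, ht⟩ => ?_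
    have huv : g u = g v := by
      rw [(trackWithin_eq_some.1 ht).2, (trackWithin_eq_some.1 (h.trans ht)).2]
    rw [hg u v a huv]

end Automata

/-! ### Padded pairs of words -/

section Padding

variable {A : Type*}

/-- The left word of a padded pair. -/
abbrev leftWord (w : List (Option A × Option A)) : List A := w.filterMap Prod.fst

/-- The right word of a padded pair. -/
abbrev rightWord (w : List (Option A × Option A)) : List A := w.filterMap Prod.snd

theorem filterMap_fst_zip {β : Type*} {l : List (Option A)} {r : List β}
    (h : l.length ≤ r.length) : (l.zip r).filterMap Prod.fst = l.filterMap id := by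
  conv_rhs => rw [← List.map_fst_zip h, List.filterMap_map]
  rfl

theorem filterMap_snd_zip {β : Type*} {l : List β} {r : List (Option A)}
    (h : r.length ≤ l.length) : (l.zip r).filterMap Prod.snd = r.filterMap id := by
  conv_rhs => rw [← List.map_snd_zip h, List.filterMap_map]
  rfl

/-- A way to read two words in parallel, with padding symbols filling up the shorter one at
places that a finite automaton can check. -/
structure IsPadding (δ : List A → List A → List (Option A × Option A)) : Prop where
  leftWord : ∀ u v, leftWord (δ u v) = u
  rightWord : ∀ u v, rightWord (δ u v) = v
  length : ∀ u v, (δ u v).length = max u.length v.length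
  isRegular_range : Language.IsRegular
    {w : List (Option A × Option A) | δ (Hypoplactic.leftWord w) (Hypoplactic.rightWord w) = w}

@[simp]
theorem leftWord_deltaR (u v : List A) : leftWord (deltaR u v) = u := by
  rw [deltaR, leftWord, filterMap_fst_zip (by simp; omega)]
  simp [List.filterMap_map]

@[simp]
theorem rightWord_deltaR (u v : List A) : rightWord (deltaR u v) = v := by
  rw [deltaR, rightWord, filterMap_snd_zip (by simp; omega)]
  simp [List.filterMap_map]

theorem deltaL_eq_reverse (u v : List A) : deltaL u v = (deltaR u.reverse v.reverse).reverse := by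
  rw [deltaL, deltaR, List.zip_eq_zipWith, List.zip_eq_zipWith,
    List.reverse_zipWith (by simp; omega)]
  simp

@[simp]
theorem leftWord_deltaL (u v : List A) : leftWord (deltaL u v) = u := by
  rw [deltaL_eq_reverse, leftWord, List.filterMap_reverse, ← leftWord, leftWord_deltaR,
    List.reverse_reverse]

@[simp]
theorem rightWord_deltaL (u v : List A) : rightWord (deltaL u v) = v := by
  rw [deltaL_eq_reverse, rightWord, List.filterMap_reverse, ← rightWord, rightWord_deltaR,
    List.reverse_reverse]

/-- No position carries two padding symbols, and in neither component is a padding symbol followed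
by a letter. -/
def PaddedOnRight (w : List (Option A × Option A)) : Prop :=
  (none, none) ∉ w ∧ w.Pairwise fun x y =>
    (x.1 = none → y.1 = none) ∧ (x.2 = none → y.2 = none)

theorem deltaR_nil_left (v : List A) : deltaR [] v = v.map fun b => (none, some b) := by
  induction v with
  | nil => rfl
  | cons b v ih => simpa [deltaR, List.replicate_succ] using ih

theorem deltaR_nil_right (u : List A) : deltaR u [] = u.map fun a => (some a, none) := by
  induction u with
  | nil => rfl
  | cons a u ih => simpa [deltaR, List.replicate_succ] using ih

theorem deltaR_cons_cons (a b : A) (u v : List A) :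
    deltaR (a :: u) (b :: v) = (some a, some b) :: deltaR u v := by
  simp [deltaR]

theorem paddedOnRight_deltaR (u v : List A) : PaddedOnRight (deltaR u v) := by
  induction u generalizing v with
  | nil => simp [deltaR_nil_left, PaddedOnRight, List.pairwise_map, List.pairwise_of_forall]
  | cons a u ih =>
    rcases v with _ | ⟨b, v⟩
    · simp [deltaR_nil_right, PaddedOnRight, List.pairwise_map, List.pairwise_of_forall]
    · simpa [deltaR_cons_cons, PaddedOnRight] using ih v

theorem PaddedOnRight.deltaR_eq {w : List (Option A × Option A)} (h : PaddedOnRight w) :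
    deltaR (leftWord w) (rightWord w) = w := by
  induction w with
  | nil => rfl
  | cons x w ih =>
    obtain ⟨h₁, h₂⟩ := h
    rw [List.pairwise_cons] at h₂
    have ih := ih ⟨fun h => h₁ (.tail _ h), h₂.2⟩
    rcases x with ⟨_ | a, _ | b⟩
    · simp at h₁
    · have : leftWord w = [] := List.filterMap_eq_nil_iff.2 fun y hy => (h₂.1 y hy).1 rfl
      rw [this, deltaR_nil_left] at ih
      simpa [leftWord, this, deltaR_nil_left] using ih
    · have : rightWord w = [] := List.filterMap_eq_nil_iff.2 fun y hy => (h₂.1 y hy).2 rfl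
      rw [this, deltaR_nil_right] at ih
      simpa [rightWord, this, deltaR_nil_right] using ih
    · simpa [deltaR_cons_cons] using ih

theorem deltaR_eq_iff {w : List (Option A × Option A)} :
    deltaR (leftWord w) (rightWord w) = w ↔ PaddedOnRight w :=
  ⟨fun h => h ▸ paddedOnRight_deltaR _ _, PaddedOnRight.deltaR_eq⟩

theorem paddedOnRight_of_shortSublists_eq {w w' : List (Option A × Option A)}
    (h : shortSublists 2 w = shortSublists 2 w') (hw : PaddedOnRight w) : PaddedOnRight w' := by
  refine ⟨?_, ?_⟩
  · rw [← List.singleton_sublist, ← sublist_iff_of_shortSublists_eq h _ (by simp),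
      List.singleton_sublist]
    exact hw.1
  · rw [List.pairwise_iff_forall_sublist]
    intro x y hxy
    exact List.pairwise_iff_forall_sublist.1 hw.2
      ((sublist_iff_of_shortSublists_eq h _ (by simp)).2 hxy)

theorem isPadding_deltaR [Finite A] : IsPadding (deltaR (A := A)) where
  leftWord := leftWord_deltaR
  rightWord := rightWord_deltaR
  length u v := by simp [deltaR]; omega
  isRegular_range := (finiteState_shortSublists 2).isRegular fun w w' h hw =>
    deltaR_eq_iff.2 (paddedOnRight_of_shortSublists_eq h (deltaR_eq_iff.1 hw))

theorem isPadding_deltaL [Finite A] : IsPadding (deltaL (A := A)) where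
  leftWord := leftWord_deltaL
  rightWord := rightWord_deltaL
  length u v := by simp [deltaL]; omega
  isRegular_range := by
    refine Language.IsRegular.of_reverse ?_
    refine (congrArg Language.IsRegular (Language.ext fun w => ?_)).mpr
      (isPadding_deltaR (A := A)).isRegular_range
    change deltaL (leftWord w.reverse) (rightWord w.reverse) = w.reverse ↔
      deltaR (leftWord w) (rightWord w) = w
    rw [deltaL_eq_reverse, List.reverse_inj, leftWord, rightWord, List.filterMap_reverse,
      List.filterMap_reverse, List.reverse_reverse, List.reverse_reverse]

theorem length_filterMap_append_le {α β : Type*} (f : α → Option β) (p s : List α) :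
    p.length + ((p ++ s).filterMap f).length ≤ (p.filterMap f).length + (p ++ s).length := by
  have := List.length_filterMap_le f s
  simp only [List.filterMap_append, List.length_append]
  omega

/-- If the lengths of two words differ by at most one, then so do the lengths of the parts read
up to any moment. -/
theorem IsPadding.length_prefix {δ : List A → List A → List (Option A × Option A)}
    (hδ : IsPadding δ) {u v : List A} (huv : u.length ≤ v.length + 1)
    (hvu : v.length ≤ u.length + 1)
    {p s : List (Option A × Option A)} (h : δ u v = p ++ s) :
    (Hypoplactic.leftWord p).length ≤ (Hypoplactic.rightWord p).length + 1 ∧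
      (Hypoplactic.rightWord p).length ≤ (Hypoplactic.leftWord p).length + 1 := by
  have h₁ : p.length + (Hypoplactic.leftWord (p ++ s)).length ≤
      (Hypoplactic.leftWord p).length + (p ++ s).length := length_filterMap_append_le _ p s
  have h₂ : p.length + (Hypoplactic.rightWord (p ++ s)).length ≤
      (Hypoplactic.rightWord p).length + (p ++ s).length := length_filterMap_append_le _ p s
  have h₃ : (Hypoplactic.leftWord p).length ≤ p.length := List.length_filterMap_le _ p
  have h₄ : (Hypoplactic.rightWord p).length ≤ p.length := List.length_filterMap_le _ p
  rw [← h, hδ.leftWord, hδ.length] at h₁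
  rw [← h, hδ.rightWord, hδ.length] at h₂
  omega

/-! ### Regularity of the multiplication relations -/

/-- How many more times each letter occurs in the right word of a padded pair than in the
left word. -/
def contentDifference {n : ℕ} (w : List (Option (Fin n) × Option (Fin n))) (y : Fin n) : ℤ :=
  (rightWord w).count y - (leftWord w).count y

theorem updatable_contentDifference {n : ℕ} : Updatable (contentDifference (n := n)) := by
  intro u v a h
  ext y
  have := congrFun h y
  simp only [contentDifference, rightWord, leftWord, List.filterMap_append, List.count_append]
    at this ⊢
  push_cast
  linarith

/-- Let `R` be a relation between words that decrease between inversions, such that the content of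
the second word exceeds the content of the first one by a fixed multiset of at most one letter, and
which otherwise only depends on the subsequences of length at most three. Then `R` is regular, for
any of the two paddings: while reading a pair in `R` the difference of the contents stays bounded,
so that a finite automaton can keep track of it. -/
theorem IsPadding.isRegular {n : ℕ}
    {δ : List (Fin n) → List (Fin n) → List (Option (Fin n) × Option (Fin n))}
    (hδ : IsPadding δ) (a : List (Fin n)) (ha : a.length ≤ 1)
    {P : List (Fin n) → List (Fin n) → Prop}
    (hP : ∀ u u' v v', shortSublists 3 u = shortSublists 3 u' →
      shortSublists 3 v = shortSublists 3 v' → P u v → P u' v')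
    {R : Set (List (Fin n) × List (Fin n))}
    (hR : ∀ u v, (u, v) ∈ R ↔ DecreasesBetweenInversions u ∧ DecreasesBetweenInversions v ∧
      (u ++ a).Perm v ∧ P u v) :
    Language.IsRegular {w : List (Option (Fin n) × Option (Fin n)) |
      ∃ p ∈ R, δ p.1 p.2 = w} := by
  let B : Set (Fin n → ℤ) := Set.Icc (fun _ => -(2 * n + 2)) fun _ => 2 * n + 2
  have hB : B.Finite := Set.finite_Icc _ _
  let f : List (Option (Fin n) × Option (Fin n)) → _ := fun w =>
    ((shortSublists 3 (Hypoplactic.leftWord w), shortSublists 3 (Hypoplactic.rightWord w)),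
      trackWithin B contentDifference w)
  have hf : FiniteState f :=
    (((finiteState_shortSublists 3).comp_filterMap Prod.fst).prodMk
      ((finiteState_shortSublists 3).comp_filterMap Prod.snd)).prodMk
      (finiteState_trackWithin hB updatable_contentDifference)
  let K : Language (Option (Fin n) × Option (Fin n)) := {w |
    DecreasesBetweenInversions (Hypoplactic.leftWord w) ∧
    DecreasesBetweenInversions (Hypoplactic.rightWord w) ∧
    P (Hypoplactic.leftWord w) (Hypoplactic.rightWord w) ∧
    trackWithin B contentDifference w = some fun y => (a.count y : ℤ)}
  have hdec : ∀ u v : List (Fin n), shortSublists 3 u = shortSublists 3 v →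
      DecreasesBetweenInversions u → DecreasesBetweenInversions v := fun u v h hu x y z hs =>
    hu x y z ((sublist_iff_of_shortSublists_eq h _ (by simp)).2 hs)
  have hK : K.IsRegular := hf.isRegular fun w w' h hw => by
    simp only [f, Prod.mk.injEq] at h
    obtain ⟨⟨h₁, h₂⟩, h₃⟩ := h
    obtain ⟨hw₁, hw₂, hw₃, hw₄⟩ := hw
    exact ⟨hdec _ _ h₁ hw₁, hdec _ _ h₂ hw₂, hP _ _ _ _ h₁ h₂ hw₃, h₃ ▸ hw₄⟩
  have hcount : ∀ u v : List (Fin n), (u ++ a).Perm v ↔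
      ∀ y, (v.count y : ℤ) - u.count y = a.count y := fun u v => by
    rw [List.perm_iff_count]
    refine forall_congr' fun y => ?_
    rw [List.count_append]
    omega
  refine (congrArg Language.IsRegular (Language.ext fun w => ?_)).mpr (hδ.isRegular_range.inf hK)
  constructor
  · rintro ⟨⟨u, v⟩, huv, rfl⟩
    obtain ⟨hu, hv, hperm, hp⟩ := (hR u v).1 huv
    refine ⟨?_, ?_⟩
    · change δ _ _ = _
      rw [hδ.leftWord, hδ.rightWord]
    · refine ⟨?_, ?_, ?_, trackWithin_eq_some.2 ⟨?_, ?_⟩⟩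
      · rwa [hδ.leftWord]
      · rwa [hδ.rightWord]
      · rwa [hδ.leftWord, hδ.rightWord]
      · rintro p ⟨s, hs⟩
        have hl := hperm.length_eq
        rw [List.length_append] at hl
        have hlen := hδ.length_prefix (u := u) (v := v) (by omega) (by omega) hs.symm
        have hu' : Hypoplactic.leftWord p ++ Hypoplactic.leftWord s = u := by
          rw [← List.filterMap_append, hs]
          exact hδ.leftWord u v
        have hv' : Hypoplactic.rightWord p ++ Hypoplactic.rightWord s = v := by
          rw [← List.filterMap_append, hs]
          exact hδ.rightWord u v
        have hc : ∀ y, u.count y ≤ v.count y ∧ v.count y ≤ u.count y + 1 := fun y => by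
          have h₁ := hperm.count_eq y
          have h₂ := List.count_le_length (a := y) (l := a)
          rw [List.count_append] at h₁
          omega
        have := abs_count_sub_count_le (hu'.symm ▸ hu) (hv'.symm ▸ hv)
          (fun y => by rw [hu', hv']; have := hc y; omega)
          (fun y => by rw [hu', hv']; exact (hc y).2) hlen.1 hlen.2
        simp only [Fintype.card_fin, abs_le] at this
        exact ⟨fun y => (this y).1, fun y => (this y).2⟩
      · ext y
        rw [contentDifference, hδ.leftWord, hδ.rightWord]
        exact (hcount u v).1 hperm y
  · rintro ⟨hw, h₁, h₂, h₃, h₄⟩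
    refine ⟨(Hypoplactic.leftWord w, Hypoplactic.rightWord w), (hR _ _).2 ⟨h₁, h₂, ?_, h₃⟩, hw⟩
    exact (hcount _ _).2 (congrFun (trackWithin_eq_some.1 h₄).2)

end Padding

/-! ### The biautomatic structure -/

/-- The part of `SameInvariants` that concerns inversions. -/
def SameInversions (u v : List (Fin n)) : Prop :=
  ∀ a b, a < b → a ∈ v → b ∈ v → (∀ c ∈ v, a < c → b ≤ c) →
    ([b, a].Sublist u ↔ [b, a].Sublist v)

theorem wordCongr_iff_perm_and_sameInversions {u v : List (Fin n)} :
    WordCongr u v ↔ u.Perm v ∧ SameInversions u v := by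
  rw [wordCongr_iff_sameInvariants]
  constructor
  · exact fun h => ⟨h.1, fun a b hab ha hb hc => (h.symm.2 a b hab ha hb hc).symm⟩
  · exact fun h => SameInvariants.symm
      ⟨h.1.symm, fun a b hab ha hb hc => (h.2 a b hab ha hb hc).symm⟩

theorem mem_iff_of_shortSublists_eq {α : Type*} {k : ℕ} {u v : List α}
    (h : shortSublists (k + 1) u = shortSublists (k + 1) v) (a : α) : a ∈ u ↔ a ∈ v := by
  rw [← List.singleton_sublist, sublist_iff_of_shortSublists_eq h _ (by simp),
    List.singleton_sublist]

theorem SameInversions.congr {u u' v v' : List (Fin n)} (h : SameInversions u v)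
    (hu : ∀ a b, [b, a].Sublist u ↔ [b, a].Sublist u')
    (hv : shortSublists 3 v = shortSublists 3 v') : SameInversions u' v' := by
  intro a b hab ha hb hc
  rw [← hu, ← sublist_iff_of_shortSublists_eq hv _ (by simp)]
  simp only [← mem_iff_of_shortSublists_eq hv] at ha hb hc
  exact h a b hab ha hb hc

theorem mem_quasiRibbonWords {w : List (Fin n)} :
    w ∈ quasiRibbonWords n ↔ DecreasesBetweenInversions w :=
  isQuasiRibbonWord_iff

theorem IsPadding.isRegular_rightMulRel
    {δ : List (Fin n) → List (Fin n) → List (Option (Fin n) × Option (Fin n))}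
    (hδ : IsPadding δ) (a : Option (Fin n)) :
    Language.IsRegular {w : List (Option (Fin n) × Option (Fin n)) |
      ∃ p ∈ rightMulRel (PresentedMonoid.of (HypoplacticRel n)) (quasiRibbonWords n) a,
        δ p.1 p.2 = w} := by
  refine hδ.isRegular a.toList (by cases a <;> simp)
    (P := fun u v => SameInversions (u ++ a.toList) v) ?_ fun u v => ?_
  · intro u u' v v' hu hv h
    refine h.congr (fun x y => ?_) hv
    rw [pair_sublist_append, pair_sublist_append, sublist_iff_of_shortSublists_eq hu _ (by simp),
      mem_iff_of_shortSublists_eq hu]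
  · exact (and_congr mem_quasiRibbonWords (and_congr mem_quasiRibbonWords
      wordCongr_iff_perm_and_sameInversions))

theorem IsPadding.isRegular_leftMulRel
    {δ : List (Fin n) → List (Fin n) → List (Option (Fin n) × Option (Fin n))}
    (hδ : IsPadding δ) (a : Option (Fin n)) :
    Language.IsRegular {w : List (Option (Fin n) × Option (Fin n)) |
      ∃ p ∈ leftMulRel (PresentedMonoid.of (HypoplacticRel n)) (quasiRibbonWords n) a,
        δ p.1 p.2 = w} := by
  refine hδ.isRegular a.toList (by cases a <;> simp)
    (P := fun u v => SameInversions (a.toList ++ u) v) ?_ fun u v => ?_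
  · intro u u' v v' hu hv h
    refine h.congr (fun x y => ?_) hv
    rw [pair_sublist_append, pair_sublist_append, sublist_iff_of_shortSublists_eq hu _ (by simp),
      mem_iff_of_shortSublists_eq hu]
  · refine (and_congr mem_quasiRibbonWords (and_congr mem_quasiRibbonWords
      (wordCongr_iff_perm_and_sameInversions.trans (and_congr_left' ?_))))
    exact ⟨List.perm_append_comm.trans, List.perm_append_comm.trans⟩

end Hypoplactic

open Hypoplactic in
theorem mainTheorem5 (n : ℕ) :
    IsBiautomaticStructure (M := HypoplacticMonoid n)
      (PresentedMonoid.of (HypoplacticRel n)) (quasiRibbonWords n) where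
  finite_alphabet := inferInstance
  generates := PresentedMonoid.closure_range_of _
  regular := (finiteState_shortSublists 3).isRegular fun u v h hu =>
    mem_quasiRibbonWords.2 fun x y z hs => mem_quasiRibbonWords.1 hu x y z
      ((sublist_iff_of_shortSublists_eq h _ (by simp)).2 hs)
  represents m := by
    obtain ⟨w, rfl⟩ := PresentedMonoid.surjective_mk m
    obtain ⟨v, hwv, hv⟩ := exists_wordCongr_decreasesBetweenInversions w.toList
    refine ⟨v, mem_quasiRibbonWords.2 hv, (Eq.symm hwv).trans (wordValue_eq_mk _)⟩
  right_deltaR := isPadding_deltaR.isRegular_rightMulRel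
  left_deltaR := isPadding_deltaR.isRegular_leftMulRel
  right_deltaL := isPadding_deltaL.isRegular_rightMulRel
  left_deltaL := isPadding_deltaL.isRegular_leftMulRel
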